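/- Consider a $K$-user degraded Gaussian multiaccess relay channel (MARC): the source inputs are $X_1,\dots,X_K$, the relay input is $X_r$, and the outputs at the relay and at the destination are $$Y_r=\sum_{k=1}^K X_k+Z_r,\qquad Y_d=Y_r+X_r+Z_\Delta ,$$ where $Z_r\sim\mathcal N(0,N_r)$ and $Z_\Delta\sim\mathcal N(0,N_\Delta)$ are independent of each other and of the inputs, $N_r>0$, $N_\Delta\ge 0$, and $N_d=N_r+N_\Delta$. An admissible input distribution is a joint law of $(X_1,\dots,X_K,X_r)$ under which $X_1,\dots,X_K$ are independent ($X_r$ may depend on them arbitrarily), with $E[X_k^2]\le P_k$ for $k=1,\dots,K$ and $E[X_r^2]\le P_r$, where $P_k,P_r>0$. Let $\mathcal K=\{1,\dots,K\}$, $\mathcal S^c=\mathcal K\setminus\mathcal S$, $X_{\mathcal S}=(X_k)_{k\in\mathcal S}$ and $C(x)=\tfrac12\log_2(1+x)$. For a constant time-sharing variable the cut-set bounds on $\sum_{k\in\mathcal S}R_k$, $\mathcal S\subseteq\mathcal K$, at the relay and at the destination are (in bits) $$I(X_{\mathcal S};Y_r\mid X_r,X_{\mathcal S^c})\qquad\text{and}\qquad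 I(X_{\mathcal S},X_r;Y_d\mid X_{\mathcal S^c}).$$ An input distribution has source–relay correlation vector $\gamma=(\gamma_k)_{k\in\mathcal K}$ if $\gamma_k\ge 0$ and $\sqrt{\gamma_kP_kP_r}=\operatorname{cov}(X_k,X_r)$ for all $k$ (for zero-mean inputs, $\operatorname{cov}(X_k,X_r)=E[X_kX_r]$). Let $\Gamma_{OB}=\{\gamma:\gamma_k\ge0\ \forall k,\ \sum_{k\in\mathcal K}\gamma_k\le1\}$, $\overline\gamma_{\mathcal S^c}=1-\sum_{k\in\mathcal S^c}\gamma_k$, $$B_{r,\mathcal S}(\gamma)=\begin{cases}C\Big(\sum_{k\in\mathcal S}\frac{P_k}{N_r}\Big)&\text{if }\sum_{k\in\mathcal S^c}\gamma_k=1,\\[4pt] C\Big(\sum_{k\in\mathcal S}\frac{P_k}{N_r}-\frac{\big(\sum_{k\in\mathcal S}\sqrt{\gamma_kP_k}\big)^2}{N_r\,\overline\gamma_{\mathcal S^c}}\Big)&\text{otherwise,}\end{cases}$$ $$B_{d,\mathcal S}(\gamma)=C\left(\frac{\sum_{k\in\mathcal S}P_k+\overline\gamma_{\mathcal S^c}P_r+2\sum_{k\in\mathcal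 S}\sqrt{\gamma_kP_kP_r}}{N_d}\right).$$ **Theorem.** 1. If an admissible input distribution has correlation vector $\gamma$, then $\gamma\in\Gamma_{OB}$ and, for every $\mathcal S\subseteq\mathcal K$, $$I(X_{\mathcal S};Y_r\mid X_r,X_{\mathcal S^c})\le B_{r,\mathcal S}(\gamma),\qquad I(X_{\mathcal S},X_r;Y_d\mid X_{\mathcal S^c})\le B_{d,\mathcal S}(\gamma).$$ 2. Both inequalities are equalities, for all $\mathcal S\subseteq\mathcal K$ simultaneously, whenever in addition the inputs are zero-mean, jointly Gaussian, with $E[X_k^2]=P_k$ for all $k$ and $E[X_r^2]=P_r$. 3. For every $\gamma\in\Gamma_{OB}$ there is an input distribution as in 2 with correlation vector $\gamma$. 4. For every $\gamma\in\Gamma_{OB}$ and $\mathcal S\subseteq\mathcal K$, $B_{r,\mathcal S}(\gamma)\ge0$ and $B_{d,\mathcal S}(\gamma)\ge0$. Thus, for each $\gamma\in\Gamma_{OB}$, the largest values of the two cut-set bounds over the admissible inputs with correlation vector $\gamma$ are $B_{r,\mathcal S}(\gamma)$ and $B_{d,\mathcal S}(\gamma)$, attained by one Gaussian input for all $\mathcal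 S$. -/

import Mathlib

open MeasureTheory ProbabilityTheory InformationTheory
open scoped ENNReal NNReal

noncomputable section

/-- Conditional mutual information `I(X;Y|Z)`, in bits, of random variables `X`, `Y`, `Z` on
`(Ω, μ)`. It is `E[D(P_{Y|X,Z} ‖ P_{Y|Z})]`, i.e. the Kullback-Leibler divergence of the law of
`((Z,X),Y)` from `P_{Z,X} ⊗ P_{Y|Z}`. The random variables may have arbitrary (in particular
singular) laws; the value may be `∞`. -/
def condMutualInfo {Ω α β γ : Type*} [MeasurableSpace Ω] [MeasurableSpace α]
    [MeasurableSpace β] [StandardBorelSpace β] [Nonempty β] [MeasurableSpace γ]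
    (X : Ω → α) (Y : Ω → β) (Z : Ω → γ) (μ : Measure Ω) [IsFiniteMeasure μ] : ℝ≥0∞ :=
  klDiv (μ.map fun ω => ((Z ω, X ω), Y ω))
      ((μ.map fun ω => (Z ω, X ω)) ⊗ₘ Kernel.prodMkRight α (condDistrib Y Z μ)) /
    ENNReal.ofReal (Real.log 2)

/-- `C(x) = log₂(1+x)/2`, the capacity in bits of a Gaussian channel of signal-to-noise
ratio `x`. -/
def awgnCapacity (x : ℝ) : ℝ := Real.logb 2 (1 + x) / 2

/-- Parameters of a degraded Gaussian multiaccess relay channel with `K` sources: the transmit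
powers of the sources and of the relay, the noise variance `Nr` at the relay and the variance `NΔ`
of the noise added between relay and destination. -/
structure DegradedGaussianMARC (K : ℕ) where
  P : Fin K → ℝ
  Pr : ℝ
  Nr : ℝ≥0
  NΔ : ℝ≥0
  P_pos : ∀ k, 0 < P k
  Pr_pos : 0 < Pr
  Nr_pos : 0 < Nr

namespace DegradedGaussianMARC

variable {K : ℕ} (M : DegradedGaussianMARC K)

/-- The noise variance at the destination. -/
def Nd : ℝ := M.Nr + M.NΔ

/-- Channel inputs `((X₁,…,X_K), X_r)` in one channel use. -/
abbrev Input (K : ℕ) : Type := (Fin K → ℝ) × ℝ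

/-- Sample space of one channel use: the inputs and the two noises `(Z_r, Z_Δ)`. -/
abbrev Sample (K : ℕ) : Type := Input K × (ℝ × ℝ)

/-- The channel inputs have law `ν`, and the noises `Z_r ∼ N(0, N_r)`, `Z_Δ ∼ N(0, N_Δ)` are
independent of each other and of the inputs. -/
def law (ν : Measure (Input K)) : Measure (Sample K) :=
  ν.prod ((gaussianReal 0 M.Nr).prod (gaussianReal 0 M.NΔ))

instance (ν : Measure (Input K)) [IsProbabilityMeasure ν] : IsProbabilityMeasure (M.law ν) := by
  unfold law; infer_instance

/-- The source inputs `X_S = (X_k)_{k ∈ S}`. -/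
def XS (S : Finset (Fin K)) (ω : Sample K) : S → ℝ := S.restrict ω.1.1

/-- The relay input. -/
def Xr (ω : Sample K) : ℝ := ω.1.2

/-- The channel output at the relay, `Y_r = ∑ X_k + Z_r`. -/
def Yr (ω : Sample K) : ℝ := ∑ k, ω.1.1 k + ω.2.1

/-- The channel output at the destination, `Y_d = Y_r + X_r + Z_Δ`. -/
def Yd (ω : Sample K) : ℝ := Yr ω + Xr ω + ω.2.2

/-- The cut-set bound at the relay, `I(X_S; Y_r | X_r, X_{Sᶜ})`, for the input law `ν`. -/
def relayBound (ν : Measure (Input K)) [IsProbabilityMeasure ν] (S : Finset (Fin K)) : ℝ≥0∞ :=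
  condMutualInfo (XS S) Yr (fun ω => (Xr ω, XS Sᶜ ω)) (M.law ν)

/-- The cut-set bound at the destination, `I(X_S, X_r; Y_d | X_{Sᶜ})`, for the input law `ν`. -/
def destBound (ν : Measure (Input K)) [IsProbabilityMeasure ν] (S : Finset (Fin K)) : ℝ≥0∞ :=
  condMutualInfo (fun ω => (XS S ω, Xr ω)) Yd (XS Sᶜ) (M.law ν)

/-- The admissible input laws: `p(x₁)⋯p(x_K) p(x_r|x₁,…,x_K)` (independent sources, a relay input
that may depend on them arbitrarily) subject to the power constraints. -/
structure IsAdmissible (ν : Measure (Input K)) : Prop where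
  indep : iIndepFun (fun (k : Fin K) (x : Input K) => x.1 k) ν
  memLp_source : ∀ k, MemLp (fun x : Input K => x.1 k) 2 ν
  memLp_relay : MemLp (fun x : Input K => x.2) 2 ν
  power_source : ∀ k, ∫ x, x.1 k ^ 2 ∂ν ≤ M.P k
  power_relay : ∫ x, x.2 ^ 2 ∂ν ≤ M.Pr

/-- `γ` is the vector of source-relay cross-correlation coefficients of the input law `ν`:
`γ_k ≥ 0` and `√(γ_k P_k P_r)` is the covariance of `X_k` and `X_r`. -/
def HasCorrelation (ν : Measure (Input K)) (γ : Fin K → ℝ) : Prop :=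
  ∀ k, 0 ≤ γ k ∧ √(γ k * M.P k * M.Pr) = cov[fun x : Input K => x.1 k, fun x => x.2; ν]

/-- Zero-mean, jointly Gaussian inputs that use the full powers. -/
structure IsFullPowerGaussian (ν : Measure (Input K)) : Prop where
  gaussian : IsGaussian ν
  mean_source : ∀ k, ∫ x, x.1 k ∂ν = 0
  mean_relay : ∫ x, x.2 ∂ν = 0
  power_source : ∀ k, ∫ x, x.1 k ^ 2 ∂ν = M.P k
  power_relay : ∫ x, x.2 ^ 2 ∂ν = M.Pr

/-- The set `Γ_OB` of correlation vectors. -/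
def GammaOB (K : ℕ) : Set (Fin K → ℝ) := {γ | (∀ k, 0 ≤ γ k) ∧ ∑ k, γ k ≤ 1}

/-- `γ̄_{Sᶜ} = 1 - ∑_{k ∈ Sᶜ} γ_k`. -/
def gammaBarCompl (γ : Fin K → ℝ) (S : Finset (Fin K)) : ℝ := 1 - ∑ k ∈ Sᶜ, γ k

/-- The closed form of the relay bound. -/
def relayClosedForm (γ : Fin K → ℝ) (S : Finset (Fin K)) : ℝ :=
  if ∑ k ∈ Sᶜ, γ k = 1 then
    awgnCapacity (∑ k ∈ S, M.P k / M.Nr)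
  else
    awgnCapacity (∑ k ∈ S, M.P k / M.Nr -
      (∑ k ∈ S, √(γ k * M.P k)) ^ 2 / (M.Nr * gammaBarCompl γ S))

/-- The closed form of the destination bound. -/
def destClosedForm (γ : Fin K → ℝ) (S : Finset (Fin K)) : ℝ :=
  awgnCapacity ((∑ k ∈ S, M.P k + gammaBarCompl γ S * M.Pr +
    2 * ∑ k ∈ S, √(γ k * M.P k * M.Pr)) / M.Nd)

end DegradedGaussianMARC

end

/-! Both cut-set bounds have the form `I(X;Y|Z)` with `Y = signal + noise`, where the signal is a
linear function of the inputs and the noise is Gaussian with variance `v` and independent of them.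
For any Markov kernel `η`, `I(X;Y|Z)` is at most the divergence of the joint law from `P_{Z,X} ⊗ η`;
the gap is `D(P_{Z,Y} ‖ P_Z ⊗ η)` (`klDiv_compProd_condDistrib_le`). Take `η = N(g(Z), V)`. The
divergence is then one between Gaussian kernels of constant variance, and it sees the inputs only
through the mean square of the residual `W = signal - g(Z)` (`klDiv_compProd_gaussianKernel`). If
this is at most `q`, the choice `V = v + q` gives `C(q/v)`. No density, entropy or conditional
covariance of the inputs is needed.

The estimate `g` is linear, with coefficients that would be optimal at full power for the given `γ`.
They depend on `γ` and the powers alone, not on the actual input law. Since the sources are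
independent and the covariances with `X_r` are prescribed, the variance of `W` is a fixed number
plus a nonnegative combination of the input variances. It is therefore largest at full power
(`variance_residual_le`), where it equals the closed form. Its nonnegativity for `S = ∅` gives `γ ∈
Γ_OB`.

For full-power Gaussian inputs `W` is uncorrelated with `Z`, hence independent of it. So `N(g(Z),
V)` is the true conditional law of `Y` and no inequality is lost. Such inputs arise by letting `X_r`
be a linear combination of the sources and one fresh Gaussian variable. -/

noncomputable section

/-! ### Variational upper bound for conditional mutual information -/

section ConditionalIndependence

variable {Ω α β γ : Type*} [MeasurableSpace Ω] [MeasurableSpace α] [MeasurableSpace β]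
  [MeasurableSpace γ]

/-- Exchange of the last two coordinates. -/
def prodRightComm (γ α β : Type*) (p : (γ × α) × β) : (γ × β) × α := ((p.1.1, p.2), p.1.2)

lemma measurable_prodRightComm : Measurable (prodRightComm γ α β) := by
  unfold prodRightComm; fun_prop

/-- Conditional independence given the first coordinate is symmetric: by Tonelli the two kernels may
be integrated in either order. -/
lemma map_prodRightComm_compProd_prodMkRight (μ : Measure γ) [SFinite μ] (κ : Kernel γ α)
    [IsSFiniteKernel κ] (η : Kernel γ β) [IsSFiniteKernel η] :
    ((μ ⊗ₘ κ) ⊗ₘ Kernel.prodMkRight α η).map (prodRightComm γ α β) =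
      (μ ⊗ₘ η) ⊗ₘ Kernel.prodMkRight β κ := by
  refine Measure.ext_of_lintegral _ fun f hf => ?_
  have hs : Measurable fun p : (γ × α) × β => f (prodRightComm γ α β p) :=
    hf.comp measurable_prodRightComm
  rw [lintegral_map hf measurable_prodRightComm, Measure.lintegral_compProd hs,
    Measure.lintegral_compProd hf, Measure.lintegral_compProd hs.lintegral_kernel_prod_right',
    Measure.lintegral_compProd hf.lintegral_kernel_prod_right']
  refine lintegral_congr fun z => ?_
  simp only [Kernel.prodMkRight_apply, prodRightComm]
  exact lintegral_lintegral_swap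
    (f := fun a b => f ((z, b), a)) (hf.comp (by fun_prop)).aemeasurable

/-- Replacing `P_{Y|Z}` by another kernel in the second argument of the divergence defining
`I(X;Y|Z)` can only increase the divergence. -/
lemma klDiv_compProd_condDistrib_le [StandardBorelSpace α] [Nonempty α] [StandardBorelSpace β]
    [Nonempty β] {μ : Measure Ω} [IsProbabilityMeasure μ] {X : Ω → α} {Y : Ω → β} {Z : Ω → γ}
    (hX : Measurable X) (hY : Measurable Y) (hZ : Measurable Z)
    (η : Kernel γ β) [IsMarkovKernel η] :
    klDiv (μ.map fun ω => ((Z ω, X ω), Y ω))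
        ((μ.map fun ω => (Z ω, X ω)) ⊗ₘ Kernel.prodMkRight α (condDistrib Y Z μ)) ≤
      klDiv (μ.map fun ω => ((Z ω, X ω), Y ω))
        ((μ.map fun ω => (Z ω, X ω)) ⊗ₘ Kernel.prodMkRight α η) := by
  have := Measure.isProbabilityMeasure_map (μ := μ) hZ.aemeasurable
  have := Measure.isProbabilityMeasure_map (μ := μ) (hZ.prodMk hY).aemeasurable
  have := Measure.isProbabilityMeasure_map (μ := μ) (hZ.prodMk hX).aemeasurable
  have := Measure.isProbabilityMeasure_map (μ := μ) ((hZ.prodMk hX).prodMk hY).aemeasurable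
  have h1 : (μ.map fun ω => ((Z ω, Y ω), X ω)).map (prodRightComm γ β α) =
      μ.map fun ω => ((Z ω, X ω), Y ω) :=
    Measure.map_map measurable_prodRightComm ((hZ.prodMk hY).prodMk hX)
  have h1' : (μ.map fun ω => ((Z ω, X ω), Y ω)).map (prodRightComm γ α β) =
      μ.map fun ω => ((Z ω, Y ω), X ω) :=
    Measure.map_map measurable_prodRightComm ((hZ.prodMk hX).prodMk hY)
  have h2 := map_prodRightComm_compProd_prodMkRight (μ.map Z) (condDistrib Y Z μ)
    (condDistrib X Z μ)
  have h3 := map_prodRightComm_compProd_prodMkRight (μ.map Z) (condDistrib X Z μ) η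
  rw [compProd_map_condDistrib hX.aemeasurable] at h2 h3
  rw [compProd_map_condDistrib hY.aemeasurable] at h2
  calc
    _ ≤ klDiv (μ.map fun ω => ((Z ω, Y ω), X ω))
        ((μ.map fun ω => (Z ω, Y ω)) ⊗ₘ Kernel.prodMkRight β (condDistrib X Z μ)) := by
      rw [← h1, ← h2]
      exact klDiv_map_le _ _ measurable_prodRightComm
    _ ≤ klDiv (μ.map fun ω => ((Z ω, Y ω), X ω))
        ((μ.map Z ⊗ₘ η) ⊗ₘ Kernel.prodMkRight β (condDistrib X Z μ)) := by
      -- With `X` last, both second arguments end in the same kernel `P_{X|Z}`. The chain rule makes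
      -- the difference `D(P_{Z,Y} ‖ P_Z ⊗ η)`, which is nonnegative.
      rw [← compProd_map_condDistrib (X := fun ω => (Z ω, Y ω)) hX.aemeasurable,
        klDiv_compProd_eq_add (μ.map fun ω => (Z ω, Y ω)) (μ.map Z ⊗ₘ η)]
      exact le_add_self
    _ ≤ _ := by
      rw [← h1', ← h3]
      exact klDiv_map_le _ _ measurable_prodRightComm

end ConditionalIndependence

/-! ### Divergence between Gaussian kernels -/

section GaussianKernel

variable {Ω α γ : Type*} [MeasurableSpace Ω] [MeasurableSpace α] [MeasurableSpace γ]

/-- The kernel `a ↦ N(f a, v)`. -/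
def gaussianKernel (f : α → ℝ) (hf : Measurable f) (v : ℝ≥0) : Kernel α ℝ where
  toFun a := gaussianReal (f a) v
  measurable' := measurable_gaussianReal.comp (hf.prodMk measurable_const)

lemma gaussianKernel_apply {f : α → ℝ} (hf : Measurable f) (v : ℝ≥0) (a : α) :
    gaussianKernel f hf v a = gaussianReal (f a) v := rfl

instance {f : α → ℝ} (hf : Measurable f) (v : ℝ≥0) : IsMarkovKernel (gaussianKernel f hf v) :=
  ⟨fun a => by rw [gaussianKernel_apply]; infer_instance⟩

/-- Turns integrals over input and output into integrals over a product of input and centered noise.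
-/
lemma compProd_gaussianKernel (ρ : Measure α) [SFinite ρ] {f : α → ℝ} (hf : Measurable f)
    (v : ℝ≥0) :
    ρ ⊗ₘ gaussianKernel f hf v =
      (ρ.prod (gaussianReal 0 v)).map fun p => (p.1, f p.1 + p.2) := by
  refine Measure.ext_of_lintegral _ fun u hu => ?_
  have hm : Measurable fun p : α × ℝ => (p.1, f p.1 + p.2) := by fun_prop
  rw [Measure.lintegral_compProd hu, lintegral_map hu hm,
    lintegral_prod (fun p : α × ℝ => u (p.1, f p.1 + p.2)) (hu.comp hm).aemeasurable]
  refine lintegral_congr fun a => ?_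
  have h := gaussianReal_map_const_add (μ := 0) (v := v) (f a)
  rw [zero_add] at h
  rw [gaussianKernel_apply, ← h,
    lintegral_map (f := fun b => u (a, b)) (hu.comp (by fun_prop)) (by fun_prop)]

/-- The joint law of the input and the output of an additive Gaussian noise channel. -/
lemma map_prodMk_add_gaussian {μ : Measure Ω} [IsProbabilityMeasure μ] {A : Ω → α} {N : Ω → ℝ}
    (hA : Measurable A) (hN : Measurable N) {v : ℝ≥0} (hAN : IndepFun A N μ)
    (hlaw : μ.map N = gaussianReal 0 v) {f : α → ℝ} (hf : Measurable f) :
    (μ.map fun ω => (A ω, f (A ω) + N ω)) = μ.map A ⊗ₘ gaussianKernel f hf v := by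
  have := Measure.isProbabilityMeasure_map (μ := μ) hA.aemeasurable
  rw [compProd_gaussianKernel, ← hlaw,
    ← (indepFun_iff_map_prod_eq_prod_map_map hA.aemeasurable hN.aemeasurable).1 hAN,
    Measure.map_map (by fun_prop) (hA.prodMk hN)]
  rfl

lemma gaussianReal_eq_withDensity (m m' : ℝ) {v V : ℝ≥0} (hv : v ≠ 0) (hV : V ≠ 0) :
    gaussianReal m v = (gaussianReal m' V).withDensity fun y =>
      ENNReal.ofReal (gaussianPDFReal m v y / gaussianPDFReal m' V y) := by
  have hm : Measurable fun y =>
      ENNReal.ofReal (gaussianPDFReal m v y / gaussianPDFReal m' V y) :=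
    ((measurable_gaussianPDFReal _ _).div (measurable_gaussianPDFReal _ _)).ennreal_ofReal
  rw [gaussianReal_of_var_ne_zero _ hv, gaussianReal_of_var_ne_zero _ hV,
    ← withDensity_mul _ (measurable_gaussianPDF _ _) hm]
  congr with y
  rw [Pi.mul_apply, gaussianPDF, gaussianPDF, ← ENNReal.ofReal_mul (gaussianPDFReal_nonneg _ _ _),
    mul_div_cancel₀ _ (gaussianPDFReal_pos m' V y hV).ne']

lemma log_gaussianPDFReal_div (m m' y : ℝ) {v V : ℝ≥0} (hv : v ≠ 0) (hV : V ≠ 0) :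
    Real.log (gaussianPDFReal m v y / gaussianPDFReal m' V y) =
      Real.log (V / v) / 2 - (y - m) ^ 2 / (2 * v) + (y - m') ^ 2 / (2 * V) := by
  have hv' : (0 : ℝ) < v := NNReal.coe_pos.2 (pos_iff_ne_zero.2 hv)
  have hV' : (0 : ℝ) < V := NNReal.coe_pos.2 (pos_iff_ne_zero.2 hV)
  have key (m y : ℝ) {v : ℝ≥0} (hv : (0 : ℝ) < v) : Real.log (gaussianPDFReal m v y) =
      -(Real.log (2 * Real.pi) + Real.log v) / 2 - (y - m) ^ 2 / (2 * v) := by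
    have := Real.pi_pos
    rw [gaussianPDFReal, Real.log_mul (by positivity) (Real.exp_pos _).ne', Real.log_exp,
      Real.log_inv, Real.log_sqrt (by positivity), Real.log_mul (by positivity) hv.ne']
    ring
  rw [Real.log_div (gaussianPDFReal_pos _ _ _ hv).ne' (gaussianPDFReal_pos _ _ _ hV).ne',
    key m y hv', key m' y hV', Real.log_div hV'.ne' hv'.ne']
  ring

/-- The conditional divergence of two Gaussian kernels with constant variances. -/
lemma klDiv_compProd_gaussianKernel (ρ : Measure α) [IsProbabilityMeasure ρ] {f g : α → ℝ}
    (hf : Measurable f) (hg : Measurable g) {v V : ℝ≥0} (hv : v ≠ 0) (hV : V ≠ 0)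
    (hint : Integrable (fun a => (f a - g a) ^ 2) ρ) :
    klDiv (ρ ⊗ₘ gaussianKernel f hf v) (ρ ⊗ₘ gaussianKernel g hg V) =
      ENNReal.ofReal (Real.log (V / v) / 2 - 1 / 2 +
        (v + ∫ a, (f a - g a) ^ 2 ∂ρ) / (2 * V)) := by
  have hv' : (0 : ℝ) < v := NNReal.coe_pos.2 (pos_iff_ne_zero.2 hv)
  have hV' : (0 : ℝ) < V := NNReal.coe_pos.2 (pos_iff_ne_zero.2 hV)
  set P := ρ ⊗ₘ gaussianKernel f hf v with hP
  set Q := ρ ⊗ₘ gaussianKernel g hg V with hQ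
  set r : α × ℝ → ℝ := fun p => gaussianPDFReal (f p.1) v p.2 / gaussianPDFReal (g p.1) V p.2
    with hr
  have hpdf {f : α → ℝ} (hf : Measurable f) (v : ℝ≥0) :
      Measurable fun p : α × ℝ => gaussianPDFReal (f p.1) v p.2 :=
    measurable_uncurry_gaussianPDFReal.comp
      (f := fun p : α × ℝ => (f p.1, v, p.2)) (by fun_prop)
  have hrm : Measurable r := (hpdf hf v).div (hpdf hg V)
  have hr0 (p) : 0 < r p := div_pos (gaussianPDFReal_pos _ _ _ hv) (gaussianPDFReal_pos _ _ _ hV)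
  -- A jointly measurable explicit density yields both absolute continuity and the log-likelihood
  -- ratio.
  have hPQ : P = Q.withDensity fun p => ENNReal.ofReal (r p) := by
    refine Measure.ext_of_lintegral _ fun u hu => ?_
    rw [lintegral_withDensity_eq_lintegral_mul _ hrm.ennreal_ofReal hu,
      Measure.lintegral_compProd hu, Measure.lintegral_compProd (hrm.ennreal_ofReal.mul hu)]
    refine lintegral_congr fun a => ?_
    rw [gaussianKernel_apply, gaussianReal_eq_withDensity (f a) (g a) hv hV]
    exact lintegral_withDensity_eq_lintegral_mul _
      (hrm.ennreal_ofReal.comp (measurable_prodMk_left (x := a)))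
      (hu.comp (measurable_prodMk_left (x := a)))
  have hac : P ≪ Q := hPQ ▸ withDensity_absolutelyContinuous _ _
  have hllr : llr P Q =ᵐ[P] fun p => Real.log (V / v) / 2 - (p.2 - f p.1) ^ 2 / (2 * v) +
      (p.2 - g p.1) ^ 2 / (2 * V) := by
    refine hac.ae_le ?_
    have h := Measure.rnDeriv_withDensity Q hrm.ennreal_ofReal
    rw [← hPQ] at h
    filter_upwards [h] with p hp
    rw [llr, hp, ENNReal.toReal_ofReal (hr0 p).le]
    exact log_gaussianPDFReal_div _ _ _ hv hV
  have hPmap := compProd_gaussianKernel ρ hf v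
  rw [← hP] at hPmap
  have hm : Measurable fun p : α × ℝ => (p.1, f p.1 + p.2) := by fun_prop
  have hN2 : MemLp (fun p : α × ℝ => p.2) 2 (ρ.prod (gaussianReal 0 v)) :=
    (memLp_id_gaussianReal' 2 (by simp)).comp_snd ρ
  have hD2 : MemLp (fun p : α × ℝ => f p.1 - g p.1) 2 (ρ.prod (gaussianReal 0 v)) :=
    ((memLp_two_iff_integrable_sq (hf.sub hg).aestronglyMeasurable).2 hint).comp_fst _
  have hEN : ∫ p : α × ℝ, p.2 ^ 2 ∂(ρ.prod (gaussianReal 0 v)) = v := by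
    rw [integral_fun_snd (fun y : ℝ => y ^ 2)]
    have h := variance_fun_id_gaussianReal (μ := 0) (v := v)
    rw [variance_eq_integral (by fun_prop)] at h
    simpa using h
  have hED : ∫ p : α × ℝ, (f p.1 - g p.1) ^ 2 ∂(ρ.prod (gaussianReal 0 v)) =
      ∫ a, (f a - g a) ^ 2 ∂ρ := by
    rw [integral_fun_fst (fun a => (f a - g a) ^ 2)]
    simp
  have hEND : ∫ p : α × ℝ, (f p.1 - g p.1) * p.2 ∂(ρ.prod (gaussianReal 0 v)) = 0 := by
    rw [integral_prod_mul (fun a => f a - g a) (fun y : ℝ => y), integral_id_gaussianReal, mul_zero]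
  -- The cross term `(f - g) * noise` is isolated because it integrates to zero.
  have hexp (p : α × ℝ) : Real.log (V / v) / 2 - (f p.1 + p.2 - f p.1) ^ 2 / (2 * v) +
      (f p.1 + p.2 - g p.1) ^ 2 / (2 * V) = Real.log (V / v) / 2 +
        (p.2 ^ 2 * (1 / (2 * V) - 1 / (2 * v)) + ((f p.1 - g p.1) ^ 2 * (1 / (2 * V)) +
          (f p.1 - g p.1) * p.2 * (1 / V))) := by
    field_simp; ring
  have hi1 := hN2.integrable_sq.mul_const (1 / (2 * V) - 1 / (2 * v) : ℝ)
  have hi2 := hD2.integrable_sq.mul_const (1 / (2 * V) : ℝ)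
  have hi3 := (hD2.integrable_mul hN2).mul_const (1 / V : ℝ)
  simp only [Pi.mul_apply] at hi3
  have hllr_meas : AEStronglyMeasurable (fun p : α × ℝ => Real.log (V / v) / 2 -
      (p.2 - f p.1) ^ 2 / (2 * v) + (p.2 - g p.1) ^ 2 / (2 * V))
      ((ρ.prod (gaussianReal 0 v)).map fun p => (p.1, f p.1 + p.2)) :=
    Measurable.aestronglyMeasurable (by fun_prop)
  have hint_llr : Integrable (llr P Q) P := by
    rw [integrable_congr hllr, hPmap, integrable_map_measure hllr_meas hm.aemeasurable]
    exact ((integrable_const (Real.log (V / v) / 2)).add (hi1.add (hi2.add hi3))).congr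
      (.of_forall fun p => (hexp p).symm)
  rw [klDiv_of_ac_of_integrable hac hint_llr, probReal_univ, probReal_univ, add_sub_cancel_right,
    integral_congr_ae hllr, hPmap, integral_map hm.aemeasurable hllr_meas]
  simp only [hexp]
  have hi4 := hi2.add hi3
  have hi5 := hi1.add hi4
  simp only [Pi.add_def] at hi4 hi5
  rw [integral_add (integrable_const _) hi5, integral_add hi1 hi4, integral_add hi2 hi3,
    integral_mul_const, integral_mul_const, integral_mul_const, hEN, hED, hEND, integral_const,
    probReal_univ]
  congr 1
  simp only [smul_eq_mul]
  field_simp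
  ring

end GaussianKernel

/-! ### Conditional mutual information over a Gaussian noise channel -/

section Capacity

variable {Ω α γ : Type*} [MeasurableSpace Ω] [MeasurableSpace α] [MeasurableSpace γ]
  {μ : Measure Ω} [IsProbabilityMeasure μ]
  {X : Ω → α} {Y N : Ω → ℝ} {Z : Ω → γ} {F : γ × α → ℝ} {g : γ → ℝ} {v : ℝ≥0} {q : ℝ}

lemma awgnCapacity_eq_log (x : ℝ) : awgnCapacity x = Real.log (1 + x) / 2 / Real.log 2 := by
  rw [awgnCapacity, Real.logb]; ring

/-- Only the second moment of the estimation error `W` enters, whatever the law of the inputs. -/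
lemma klDiv_gaussian_noise {W : Ω → ℝ}
    (hX : Measurable X) (hZ : Measurable Z) (hN : Measurable N) (hF : Measurable F)
    (hg : Measurable g) (hY : ∀ ω, Y ω = F (Z ω, X ω) + N ω)
    (hW : ∀ ω, F (Z ω, X ω) - g (Z ω) = W ω)
    (hindep : IndepFun (fun ω => (Z ω, X ω)) N μ) (hlaw : μ.map N = gaussianReal 0 v) (hv : v ≠ 0)
    (hW2 : MemLp W 2 μ) {V : ℝ≥0} (hV : V ≠ 0) :
    klDiv (μ.map fun ω => ((Z ω, X ω), Y ω))
        ((μ.map fun ω => (Z ω, X ω)) ⊗ₘ Kernel.prodMkRight α (gaussianKernel g hg V)) =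
      ENNReal.ofReal (Real.log (V / v) / 2 - 1 / 2 + (v + ∫ ω, W ω ^ 2 ∂μ) / (2 * V)) := by
  have hZX := hZ.prodMk hX
  have := Measure.isProbabilityMeasure_map (μ := μ) hZX.aemeasurable
  have h1 : (μ.map fun ω => ((Z ω, X ω), Y ω)) =
      (μ.map fun ω => (Z ω, X ω)) ⊗ₘ gaussianKernel F hF v := by
    simp only [hY]
    exact map_prodMk_add_gaussian hZX hN hindep hlaw hF
  have hg' : Measurable fun p : γ × α => g p.1 := hg.comp measurable_fst
  have h2 : Kernel.prodMkRight α (gaussianKernel g hg V) = gaussianKernel _ hg' V := rfl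
  have hm : Measurable fun p : γ × α => (F p - g p.1) ^ 2 := by fun_prop
  rw [h1, h2, klDiv_compProd_gaussianKernel _ hF hg' hv hV,
    integral_map hZX.aemeasurable hm.aestronglyMeasurable]
  · simp only [hW]
  · rw [integrable_map_measure hm.aestronglyMeasurable hZX.aemeasurable]
    exact hW2.integrable_sq.congr (.of_forall fun ω => by simp [hW])

/-- Over an additive Gaussian noise channel, `I(X;Y|Z)` is the capacity of the signal-to-noise ratio
that remains after subtracting an estimate `g(Z)` of the signal, if the remaining signal plus noise
is Gaussian and independent of `Z`. -/
lemma condMutualInfo_eq_awgnCapacity {W : Ω → ℝ}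
    (hX : Measurable X) (hZ : Measurable Z) (hN : Measurable N) (hF : Measurable F)
    (hg : Measurable g) (hY : ∀ ω, Y ω = F (Z ω, X ω) + N ω)
    (hW : ∀ ω, F (Z ω, X ω) - g (Z ω) = W ω) (hWm : Measurable W)
    (hindep : IndepFun (fun ω => (Z ω, X ω)) N μ) (hlaw : μ.map N = gaussianReal 0 v) (hv : v ≠ 0)
    (hW2 : MemLp W 2 μ) (hq : ∫ ω, W ω ^ 2 ∂μ = q)
    (hindep' : IndepFun Z (fun ω => W ω + N ω) μ)
    (hlaw' : μ.map (fun ω => W ω + N ω) = gaussianReal 0 (v + q.toNNReal)) :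
    condMutualInfo X Y Z μ = ENNReal.ofReal (awgnCapacity (q / v)) := by
  have hv' : (0 : ℝ) < v := NNReal.coe_pos.2 (pos_iff_ne_zero.2 hv)
  have hq0 : 0 ≤ q := (integral_nonneg fun ω => sq_nonneg (W ω)).trans hq.le
  have hYm : Measurable Y := by
    rw [show Y = fun ω => F (Z ω, X ω) + N ω from funext hY]
    fun_prop
  set V : ℝ≥0 := v + q.toNNReal with hVdef
  have hVq : (V : ℝ) = v + q := by simp [hVdef, hq0]
  have hV : V ≠ 0 := by
    rw [← NNReal.coe_ne_zero, hVq]; positivity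
  -- `Y = g(Z) + (W + N)` is itself a Gaussian noise channel with input `Z`, so its conditional law
  -- is known.
  have hcond : condDistrib Y Z μ =ᵐ[μ.map Z] gaussianKernel g hg V := by
    refine condDistrib_ae_eq_of_measure_eq_compProd Z hYm.aemeasurable ?_
    rw [← map_prodMk_add_gaussian hZ (hWm.add hN) hindep' hlaw' hg]
    congr with ω
    · rfl
    · simp only [hY, Pi.add_apply, ← hW]; ring
  have hker : Kernel.prodMkRight α (condDistrib Y Z μ) =ᵐ[μ.map fun ω => (Z ω, X ω)]
      Kernel.prodMkRight α (gaussianKernel g hg V) := by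
    have : (μ.map fun ω => (Z ω, X ω)).map Prod.fst = μ.map Z :=
      Measure.map_map measurable_fst (hZ.prodMk hX)
    rw [← this] at hcond
    exact ae_of_ae_map measurable_fst.aemeasurable hcond
  rw [condMutualInfo, awgnCapacity_eq_log, ENNReal.ofReal_div_of_pos (Real.log_pos one_lt_two),
    Measure.compProd_congr hker,
    klDiv_gaussian_noise hX hZ hN hF hg hY hW hindep hlaw hv hW2 hV, hq, ← hVq]
  congr 2
  have h1 : (V / v : ℝ) = 1 + q / v := by rw [hVq]; field_simp
  have h2 : (V : ℝ) / (2 * V) = 1 / 2 := by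
    have : (V : ℝ) ≠ 0 := NNReal.coe_ne_zero.2 hV
    field_simp
  rw [h1, h2]; ring

variable [StandardBorelSpace α] [Nonempty α]

/-- Over an additive Gaussian noise channel, `I(X;Y|Z)` is at most the capacity of the
signal-to-noise ratio that remains after subtracting any estimate `g(Z)` of the signal. -/
lemma condMutualInfo_le_awgnCapacity {W : Ω → ℝ}
    (hX : Measurable X) (hZ : Measurable Z) (hN : Measurable N) (hF : Measurable F)
    (hg : Measurable g) (hY : ∀ ω, Y ω = F (Z ω, X ω) + N ω)
    (hW : ∀ ω, F (Z ω, X ω) - g (Z ω) = W ω)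
    (hindep : IndepFun (fun ω => (Z ω, X ω)) N μ) (hlaw : μ.map N = gaussianReal 0 v) (hv : v ≠ 0)
    (hW2 : MemLp W 2 μ) (hq : ∫ ω, W ω ^ 2 ∂μ ≤ q) :
    condMutualInfo X Y Z μ ≤ ENNReal.ofReal (awgnCapacity (q / v)) := by
  have hv' : (0 : ℝ) < v := NNReal.coe_pos.2 (pos_iff_ne_zero.2 hv)
  have hq0 : 0 ≤ q := (integral_nonneg fun ω => sq_nonneg (W ω)).trans hq
  have hYm : Measurable Y := by
    rw [show Y = fun ω => F (Z ω, X ω) + N ω from funext hY]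
    fun_prop
  set V : ℝ≥0 := v + q.toNNReal with hVdef
  have hVq : (V : ℝ) = v + q := by simp [hVdef, hq0]
  have hV : V ≠ 0 := by
    rw [← NNReal.coe_ne_zero, hVq]; positivity
  rw [condMutualInfo, awgnCapacity_eq_log, ENNReal.ofReal_div_of_pos (Real.log_pos one_lt_two)]
  gcongr
  refine (klDiv_compProd_condDistrib_le hX hYm hZ (gaussianKernel g hg V)).trans ?_
  rw [klDiv_gaussian_noise hX hZ hN hF hg hY hW hindep hlaw hv hW2 hV]
  refine ENNReal.ofReal_le_ofReal ?_
  have h1 : (V / v : ℝ) = 1 + q / v := by rw [hVq]; field_simp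
  -- With `V = v + q` this term is absorbed by the `-1/2` and only the logarithm remains.
  have h2 : (v + ∫ ω, W ω ^ 2 ∂μ) / (2 * V) ≤ 1 / 2 := by
    rw [hVq, div_le_iff₀ (by positivity)]; linarith
  rw [h1]; linarith

end Capacity

namespace DegradedGaussianMARC

variable {K : ℕ}

/-! ### Second moments of linear combinations of the inputs -/

section LinearInput

/-- The linear combination `∑ b_k X_k + a X_r` of the inputs. -/
def linInput (b : Fin K → ℝ) (a : ℝ) : Input K →L[ℝ] ℝ :=
  (∑ k, b k • ContinuousLinearMap.proj k).comp (ContinuousLinearMap.fst ℝ (Fin K → ℝ) ℝ) +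
    a • ContinuousLinearMap.snd ℝ (Fin K → ℝ) ℝ

lemma linInput_apply (b : Fin K → ℝ) (a : ℝ) (x : Input K) :
    linInput b a x = ∑ k, b k * x.1 k + a * x.2 := by
  simp [linInput]

/-- Reduces uncorrelatedness with every functional of `Z` to uncorrelatedness with single inputs. -/
lemma eq_linInput (ℓ : Input K →L[ℝ] ℝ) :
    ℓ = linInput (fun k => ℓ (Pi.single k 1, 0)) (ℓ (0, 1)) := by
  ext x
  · have h := LinearMap.pi_apply_eq_sum_univ
      (ℓ.comp (ContinuousLinearMap.inl ℝ (Fin K → ℝ) ℝ)).toLinearMap x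
    simp only [ContinuousLinearMap.coe_coe, ContinuousLinearMap.comp_apply,
      ContinuousLinearMap.inl_apply, smul_eq_mul] at h
    simp only [ContinuousLinearMap.comp_apply, ContinuousLinearMap.inl_apply, linInput_apply,
      mul_zero, add_zero, h]
    refine Finset.sum_congr rfl fun k _ => ?_
    rw [mul_comm]
    congr 3
    ext j
    simp [Pi.single_apply, eq_comm]
  · simp [linInput_apply]

variable {ν : Measure (Input K)}

lemma memLp_linInput (hs : ∀ k, MemLp (fun x : Input K => x.1 k) 2 ν)
    (hr : MemLp (fun x : Input K => x.2) 2 ν) (b : Fin K → ℝ) (a : ℝ) :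
    MemLp (linInput b a) 2 ν := by
  have h : ⇑(linInput b a) = fun x => ∑ k, b k * x.1 k + a * x.2 := funext (linInput_apply b a)
  rw [h]
  exact (memLp_finsetSum _ fun k _ => (hs k).const_mul (b k)).add (hr.const_mul a)

variable [IsProbabilityMeasure ν]

lemma covariance_linInput_right (hs : ∀ k, MemLp (fun x : Input K => x.1 k) 2 ν)
    (hr : MemLp (fun x : Input K => x.2) 2 ν) (b : Fin K → ℝ) (a : ℝ) {U : Input K → ℝ}
    (hU : MemLp U 2 ν) :
    cov[U, linInput b a; ν] =
      ∑ k, b k * cov[U, fun x => x.1 k; ν] + a * cov[U, fun x => x.2; ν] := by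
  have h : ⇑(linInput b a) = (fun x => ∑ k, b k * x.1 k) + fun x => a * x.2 :=
    funext (linInput_apply b a)
  rw [h, covariance_add_right hU (memLp_finsetSum _ fun k _ => (hs k).const_mul (b k))
    (hr.const_mul a), covariance_fun_sum_right (fun k => (hs k).const_mul (b k)) hU,
    covariance_const_mul_right]
  simp only [covariance_const_mul_right]

lemma covariance_source_linInput (hi : iIndepFun (fun (k : Fin K) (x : Input K) => x.1 k) ν)
    (hs : ∀ k, MemLp (fun x : Input K => x.1 k) 2 ν)
    (hr : MemLp (fun x : Input K => x.2) 2 ν) (b : Fin K → ℝ) (a : ℝ) (j : Fin K) :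
    cov[fun x : Input K => x.1 j, linInput b a; ν] =
      b j * Var[fun x : Input K => x.1 j; ν] + a * cov[fun x : Input K => x.1 j, fun x => x.2; ν] := by
  rw [covariance_linInput_right hs hr b a (hs j), Finset.sum_eq_single j,
    covariance_self (hs j).aemeasurable]
  · intro k _ hk
    rw [(hi.indepFun hk.symm).covariance_eq_zero (hs j) (hs k), mul_zero]
  · simp

lemma covariance_relay_linInput (hs : ∀ k, MemLp (fun x : Input K => x.1 k) 2 ν)
    (hr : MemLp (fun x : Input K => x.2) 2 ν) (b : Fin K → ℝ) (a : ℝ) :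
    cov[fun x : Input K => x.2, linInput b a; ν] =
      ∑ k, b k * cov[fun x : Input K => x.1 k, fun x => x.2; ν] +
        a * Var[fun x : Input K => x.2; ν] := by
  rw [covariance_linInput_right hs hr b a hr, covariance_self hr.aemeasurable]
  simp only [covariance_comm (fun x : Input K => x.2)]

/-- Independence removes the source-source cross terms. With the covariances fixed, the rest is
nondecreasing in every input variance. -/
lemma variance_linInput (hi : iIndepFun (fun (k : Fin K) (x : Input K) => x.1 k) ν)
    (hs : ∀ k, MemLp (fun x : Input K => x.1 k) 2 ν)
    (hr : MemLp (fun x : Input K => x.2) 2 ν) (b : Fin K → ℝ) (a : ℝ) :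
    Var[linInput b a; ν] = ∑ k, b k ^ 2 * Var[fun x : Input K => x.1 k; ν] +
      a ^ 2 * Var[fun x : Input K => x.2; ν] +
      2 * a * ∑ k, b k * cov[fun x : Input K => x.1 k, fun x => x.2; ν] := by
  have hl := memLp_linInput hs hr b a
  rw [← covariance_self hl.aemeasurable, covariance_linInput_right hs hr b a hl,
    covariance_comm _ (fun x : Input K => x.2), covariance_relay_linInput hs hr]
  have h (k) : b k * cov[linInput b a, fun x : Input K => x.1 k; ν] =
      b k ^ 2 * Var[fun x : Input K => x.1 k; ν] +
        a * (b k * cov[fun x : Input K => x.1 k, fun x => x.2; ν]) := by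
    rw [covariance_comm, covariance_source_linInput hi hs hr]; ring
  simp only [h, Finset.sum_add_distrib, ← Finset.mul_sum]
  ring

end LinearInput

/-! ### The channel bounds in terms of the residual variance -/

section AdditiveNoise

variable {α γ : Type*} [MeasurableSpace α] {ν : Measure (Input K)} [IsProbabilityMeasure ν]
  {τ : Measure (ℝ × ℝ)} [IsProbabilityMeasure τ] {X : Input K → α} {Z : Input K → γ}
  {Y : Sample K → ℝ} {n : ℝ × ℝ → ℝ} {F : γ × α → ℝ} {g : γ → ℝ} {W : Input K → ℝ} {v : ℝ≥0}
  {q : ℝ}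

lemma map_comp_snd_prod (hn : Measurable n) (hlaw : τ.map n = gaussianReal 0 v) :
    (ν.prod τ).map (fun ω => n ω.2) = gaussianReal 0 v := by
  have h : (fun ω : Sample K => n ω.2) = n ∘ Prod.snd := rfl
  rw [h, ← Measure.map_map hn measurable_snd, Measure.map_snd_prod, measure_univ, one_smul, hlaw]

/-- Adding the mean of `W` to the estimate replaces its second moment by its variance, so the inputs
need not be centered. -/
lemma condMutualInfo_le_of_variance_le [MeasurableSpace γ] [StandardBorelSpace α] [Nonempty α]
    (hX : Measurable X) (hZ : Measurable Z) (hn : Measurable n) (hF : Measurable F)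
    (hg : Measurable g) (hY : ∀ ω, Y ω = F (Z ω.1, X ω.1) + n ω.2)
    (hW : ∀ x, F (Z x, X x) = g (Z x) + W x) (hlaw : τ.map n = gaussianReal 0 v) (hv : v ≠ 0)
    (hW2 : MemLp W 2 ν) (hq : Var[W; ν] ≤ q) :
    condMutualInfo (fun ω => X ω.1) Y (fun ω => Z ω.1) (ν.prod τ) ≤
      ENNReal.ofReal (awgnCapacity (q / v)) := by
  refine condMutualInfo_le_awgnCapacity (N := fun ω => n ω.2) (F := F)
    (g := fun z => g z + ∫ x, W x ∂ν) (W := fun ω => W ω.1 - ∫ x, W x ∂ν)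
    (hX.comp measurable_fst) (hZ.comp measurable_fst) (hn.comp measurable_snd) hF
    (hg.add_const _) hY (fun ω => by rw [hW]; ring)
    (indepFun_prod (hZ.prodMk hX) hn) (map_comp_snd_prod hn hlaw) hv
    ((hW2.sub (memLp_const _)).comp_fst _) ?_
  rw [variance_eq_integral hW2.aemeasurable] at hq
  rwa [integral_fun_fst (fun x => (W x - ∫ x, W x ∂ν) ^ 2), probReal_univ, one_smul]

/-- `Z` and `W + n` are jointly Gaussian, so vanishing covariances make them independent. -/
lemma condMutualInfo_eq_of_isGaussian [NormedAddCommGroup γ] [NormedSpace ℝ γ]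
    [FiniteDimensional ℝ γ] [MeasurableSpace γ] [BorelSpace γ] [IsGaussian ν] [IsGaussian τ]
    {Z : Input K →L[ℝ] γ} {n : ℝ × ℝ →L[ℝ] ℝ} {W : Input K →L[ℝ] ℝ}
    (hX : Measurable X) (hF : Measurable F)
    (hg : Measurable g) (hY : ∀ ω, Y ω = F (Z ω.1, X ω.1) + n ω.2)
    (hW : ∀ x, F (Z x, X x) = g (Z x) + W x) (hlaw : τ.map n = gaussianReal 0 v) (hv : v ≠ 0)
    (hmean : ∫ x, W x ∂ν = 0) (hq : Var[W; ν] = q)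
    (hcov : ∀ ℓ : StrongDual ℝ γ, cov[ℓ.comp Z, W; ν] = 0) :
    condMutualInfo (fun ω => X ω.1) Y (fun ω => Z ω.1) (ν.prod τ) =
      ENNReal.ofReal (awgnCapacity (q / v)) := by
  have hZ : Measurable Z := Z.continuous.measurable
  have hn : Measurable n := n.continuous.measurable
  have hWm : Measurable W := W.continuous.measurable
  have hW2 : MemLp W 2 ν := IsGaussian.memLp_dual ν W 2 (by simp)
  have hn2 : MemLp n 2 τ := IsGaussian.memLp_dual τ n 2 (by simp)
  have hnlaw := map_comp_snd_prod (ν := ν) hn hlaw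
  have hpair : HasGaussianLaw (fun ω : Sample K => (Z ω.1, W ω.1 + n ω.2)) (ν.prod τ) :=
    (IsGaussian.hasGaussianLaw_id (μ := ν.prod τ)).map
      ((Z.comp (ContinuousLinearMap.fst ℝ _ _)).prod
        (W.comp (ContinuousLinearMap.fst ℝ _ _) + n.comp (ContinuousLinearMap.snd ℝ _ _)))
  have hWlaw : (ν.prod τ).map (fun ω => W ω.1) = gaussianReal 0 q.toNNReal := by
    have h : (fun ω : Sample K => W ω.1) = W ∘ Prod.fst := rfl
    rw [h, ← Measure.map_map hWm measurable_fst, Measure.map_fst_prod, measure_univ, one_smul,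
      IsGaussian.map_eq_gaussianReal W, hq, hmean]
  refine condMutualInfo_eq_awgnCapacity (N := fun ω => n ω.2) (F := F)
    (g := g) (W := fun ω => W ω.1) (hX.comp measurable_fst) (hZ.comp measurable_fst)
    (hn.comp measurable_snd) hF hg hY (fun ω => by rw [hW]; ring) (hWm.comp measurable_fst)
    (indepFun_prod (hZ.prodMk hX) hn) hnlaw hv (hW2.comp_fst _) ?_ ?_ ?_
  · rw [integral_fun_fst (fun x => W x ^ 2), probReal_univ, one_smul, ← hq,
      variance_of_integral_eq_zero hW2.aemeasurable hmean]
  · refine hpair.indepFun_of_covariance_strongDual fun ℓ ℓ' => ?_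
    have hℓ2 : MemLp (ℓ.comp Z) 2 ν := IsGaussian.memLp_dual ν _ 2 (by simp)
    have h1 : ℓ ∘ (fun ω : Sample K => Z ω.1) = fun ω => (ℓ.comp Z) ω.1 := rfl
    have h2 : ℓ' ∘ (fun ω : Sample K => W ω.1 + n ω.2) =
        fun ω => ((fun ω : Sample K => W ω.1) + fun ω : Sample K => n ω.2) ω * ℓ' 1 := by
      ext ω
      rw [Function.comp_apply, ← smul_eq_mul, ← map_smul, smul_eq_mul, mul_one]; rfl
    have h3 : cov[fun ω => (ℓ.comp Z) ω.1, fun ω => W ω.1; ν.prod τ] = cov[ℓ.comp Z, W; ν] := by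
      have := covariance_map_fun (μ := ν.prod τ) (Z := Prod.fst) (X := ℓ.comp Z) (Y := W)
        (by fun_prop) (by fun_prop) (by fun_prop)
      rwa [Measure.map_fst_prod, measure_univ, one_smul, eq_comm] at this
    rw [h1, h2, covariance_mul_const_right, covariance_add_right (hℓ2.comp_fst _)
      (hW2.comp_fst _) (hn2.comp_snd _), h3, hcov, covariance_fst_snd_prod hℓ2 hn2, zero_add,
      zero_mul]
  · have h := gaussianReal_add_gaussianReal_of_indepFun (indepFun_prod hWm hn) hWlaw hnlaw
    rw [zero_add, add_comm q.toNNReal] at h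
    exact h

end AdditiveNoise

variable (M : DegradedGaussianMARC K)

/-! ### Coefficients of the linear estimates and the closed forms -/

section Coefficients

/-- The coefficients of the part of `∑ X_k + a X_r` that the best linear estimate from `X_{Sᶜ}`
leaves over, for full-power inputs with source-relay correlation `γ`. -/
def residualCoeff (γ : Fin K → ℝ) (S : Finset (Fin K)) (a : ℝ) (k : Fin K) : ℝ :=
  if k ∈ S then 1 else -(a * (√(γ k * M.P k * M.Pr) / M.P k))

/-- The residual signal power for full-power inputs. -/
def residualPower (γ : Fin K → ℝ) (S : Finset (Fin K)) (a : ℝ) : ℝ :=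
  ∑ k ∈ S, M.P k + a ^ 2 * (gammaBarCompl γ S * M.Pr) + 2 * a * ∑ k ∈ S, √(γ k * M.P k * M.Pr)

variable {M} {γ : Fin K → ℝ}

lemma sq_sqrt_correlation (hγ : ∀ k, 0 ≤ γ k) (k : Fin K) :
    √(γ k * M.P k * M.Pr) ^ 2 = γ k * M.P k * M.Pr :=
  Real.sq_sqrt (mul_nonneg (mul_nonneg (hγ k) (M.P_pos k).le) M.Pr_pos.le)

lemma sum_residualCoeff_mul_sqrt (hγ : ∀ k, 0 ≤ γ k) (S : Finset (Fin K)) (a : ℝ) :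
    ∑ k, M.residualCoeff γ S a k * √(γ k * M.P k * M.Pr) =
      ∑ k ∈ S, √(γ k * M.P k * M.Pr) - a * (∑ k ∈ Sᶜ, γ k) * M.Pr := by
  rw [← Finset.sum_add_sum_compl S, sub_eq_add_neg]
  congr 1
  · exact Finset.sum_congr rfl fun k hk => by simp [residualCoeff, hk]
  · rw [mul_assoc, Finset.sum_mul, Finset.mul_sum, ← Finset.sum_neg_distrib]
    refine Finset.sum_congr rfl fun k hk => ?_
    have hP := (M.P_pos k).ne'
    have h := sq_sqrt_correlation (M := M) hγ k
    rw [residualCoeff, if_neg (Finset.mem_compl.1 hk)]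
    field_simp
    rw [h]; ring

/-- Each `k ∈ Sᶜ` contributes `a²γ_k P_r` through its square and `-2a²γ_k P_r` through its
covariance; the net loss turns `P_r` into `γ̄_{Sᶜ} P_r`. -/
lemma residualPower_eq (hγ : ∀ k, 0 ≤ γ k) (S : Finset (Fin K)) (a : ℝ) :
    M.residualPower γ S a = ∑ k, M.residualCoeff γ S a k ^ 2 * M.P k + a ^ 2 * M.Pr +
      2 * a * ∑ k, M.residualCoeff γ S a k * √(γ k * M.P k * M.Pr) := by
  have h1 : ∑ k, M.residualCoeff γ S a k ^ 2 * M.P k =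
      ∑ k ∈ S, M.P k + a ^ 2 * (∑ k ∈ Sᶜ, γ k) * M.Pr := by
    rw [← Finset.sum_add_sum_compl S]
    congr 1
    · exact Finset.sum_congr rfl fun k hk => by simp [residualCoeff, hk]
    · rw [mul_assoc, Finset.sum_mul, Finset.mul_sum]
      refine Finset.sum_congr rfl fun k hk => ?_
      have hP := (M.P_pos k).ne'
      have h := sq_sqrt_correlation (M := M) hγ k
      rw [residualCoeff, if_neg (Finset.mem_compl.1 hk)]
      field_simp
      rw [h]; ring
  rw [h1, sum_residualCoeff_mul_sqrt hγ, residualPower, gammaBarCompl]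
  ring

lemma sum_sqrt_correlation (S : Finset (Fin K)) :
    ∑ k ∈ S, √(γ k * M.P k * M.Pr) = (∑ k ∈ S, √(γ k * M.P k)) * √M.Pr := by
  rw [Finset.sum_mul]
  exact Finset.sum_congr rfl fun k _ => Real.sqrt_mul' _ M.Pr_pos.le

variable (M γ) in
/-- The coefficient of `X_r` in the part of `∑ X_k` that the best linear estimate from
`(X_r, X_{Sᶜ})` leaves over. -/
def relayResidualCoeff (S : Finset (Fin K)) : ℝ :=
  -((∑ k ∈ S, √(γ k * M.P k * M.Pr)) / (gammaBarCompl γ S * M.Pr))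

lemma gammaBarCompl_nonneg (hγ : γ ∈ GammaOB K) (S : Finset (Fin K)) : 0 ≤ gammaBarCompl γ S := by
  have := Finset.sum_le_univ_sum_of_nonneg (s := Sᶜ) hγ.1
  rw [gammaBarCompl]; linarith [hγ.2]

lemma sum_le_gammaBarCompl (hγ : γ ∈ GammaOB K) (S : Finset (Fin K)) :
    ∑ k ∈ S, γ k ≤ gammaBarCompl γ S := by
  have := Finset.sum_add_sum_compl S γ
  rw [gammaBarCompl]; linarith [hγ.2]

lemma residualPower_relayResidualCoeff (S : Finset (Fin K)) :
    M.residualPower γ S (M.relayResidualCoeff γ S) =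
      ∑ k ∈ S, M.P k - (∑ k ∈ S, √(γ k * M.P k)) ^ 2 / gammaBarCompl γ S := by
  have hPr := M.Pr_pos
  have hsq : √M.Pr ^ 2 = M.Pr := Real.sq_sqrt hPr.le
  rw [residualPower, relayResidualCoeff, sum_sqrt_correlation]
  rcases eq_or_ne (gammaBarCompl γ S) 0 with h | h
  · simp [h]
  · field_simp
    rw [hsq]; ring

/-- The exceptional branch needs no separate treatment: when `γ̄_{Sᶜ} = 0`, the convention `x / 0 =
0` removes the subtracted term. -/
lemma relayClosedForm_eq (S : Finset (Fin K)) :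
    M.relayClosedForm γ S =
      awgnCapacity (M.residualPower γ S (M.relayResidualCoeff γ S) / M.Nr) := by
  rw [relayClosedForm, residualPower_relayResidualCoeff, sub_div, div_div, Finset.sum_div,
    mul_comm (M.Nr : ℝ)]
  split_ifs with h
  · simp [gammaBarCompl, h]
  · rfl

lemma destClosedForm_eq (S : Finset (Fin K)) :
    M.destClosedForm γ S = awgnCapacity (M.residualPower γ S 1 / (M.Nr + M.NΔ : ℝ≥0)) := by
  simp [destClosedForm, residualPower, Nd]

lemma awgnCapacity_nonneg {x : ℝ} (hx : 0 ≤ x) : 0 ≤ awgnCapacity x :=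
  div_nonneg (Real.logb_nonneg one_lt_two (by linarith)) zero_le_two

/-- Cauchy-Schwarz for `√P_k` and `√γ_k`, together with `∑_{k ∈ S} γ_k ≤ γ̄_{Sᶜ}`. -/
lemma relayClosedForm_nonneg (hγ : γ ∈ GammaOB K) (S : Finset (Fin K)) :
    0 ≤ M.relayClosedForm γ S := by
  rw [relayClosedForm_eq, residualPower_relayResidualCoeff]
  refine awgnCapacity_nonneg (div_nonneg (sub_nonneg.2 ?_) M.Nr.2)
  refine div_le_of_le_mul₀ (gammaBarCompl_nonneg hγ S)
    (Finset.sum_nonneg fun k _ => (M.P_pos k).le) ?_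
  have h := Finset.sum_mul_sq_le_sq_mul_sq S (fun k => √(M.P k)) (fun k => √(γ k))
  simp only [Real.sq_sqrt (hγ.1 _), Real.sq_sqrt (M.P_pos _).le] at h
  calc
    _ = (∑ k ∈ S, √(M.P k) * √(γ k)) ^ 2 := by
      congr 1
      exact Finset.sum_congr rfl fun k _ => by rw [Real.sqrt_mul (hγ.1 k), mul_comm]
    _ ≤ _ := h
    _ ≤ _ := mul_le_mul_of_nonneg_left (sum_le_gammaBarCompl hγ S)
      (Finset.sum_nonneg fun k _ => (M.P_pos k).le)

lemma destClosedForm_nonneg (hγ : γ ∈ GammaOB K) (S : Finset (Fin K)) :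
    0 ≤ M.destClosedForm γ S := by
  rw [destClosedForm_eq, residualPower]
  have h1 := Finset.sum_nonneg fun k (_ : k ∈ S) => (M.P_pos k).le
  have h2 := mul_nonneg (gammaBarCompl_nonneg hγ S) M.Pr_pos.le
  have h3 := Finset.sum_nonneg fun k (_ : k ∈ S) => Real.sqrt_nonneg (γ k * M.P k * M.Pr)
  exact awgnCapacity_nonneg (by positivity)

/-- The normal equation for `a`: half the derivative of the residual power vanishes. If `γ̄_{Sᶜ} =
0`, then `γ` vanishes on `S` and so do both terms. -/
lemma gammaBarCompl_mul_relayResidualCoeff (hγ : γ ∈ GammaOB K) (S : Finset (Fin K)) :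
    ∑ k ∈ S, √(γ k * M.P k * M.Pr) +
      M.relayResidualCoeff γ S * (gammaBarCompl γ S * M.Pr) = 0 := by
  have hPr := M.Pr_pos
  rcases eq_or_ne (gammaBarCompl γ S) 0 with h | h
  · have h0 : ∑ k ∈ S, γ k = 0 := le_antisymm (h ▸ sum_le_gammaBarCompl hγ S)
      (Finset.sum_nonneg fun k _ => hγ.1 k)
    have h1 := (Finset.sum_eq_zero_iff_of_nonneg fun k _ => hγ.1 k).1 h0
    rw [h, zero_mul, mul_zero, add_zero]
    exact Finset.sum_eq_zero fun k hk => by simp [h1 k hk]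
  · rw [relayResidualCoeff, neg_mul, div_mul_cancel₀ _ (mul_ne_zero h hPr.ne'), add_neg_cancel]

end Coefficients

/-! ### Residual variance of admissible inputs -/

section Moments

variable {M} {ν : Measure (Input K)} [IsProbabilityMeasure ν] {γ : Fin K → ℝ}

lemma variance_residual_le (hν : M.IsAdmissible ν) (hγ : M.HasCorrelation ν γ)
    (S : Finset (Fin K)) (a : ℝ) :
    Var[linInput (M.residualCoeff γ S a) a; ν] ≤ M.residualPower γ S a := by
  have hvar {U : Input K → ℝ} (hU : MemLp U 2 ν) : Var[U; ν] ≤ ∫ x, U x ^ 2 ∂ν :=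
    variance_le_expectation_sq hU.aestronglyMeasurable
  rw [variance_linInput hν.indep hν.memLp_source hν.memLp_relay,
    residualPower_eq fun k => (hγ k).1]
  simp only [(hγ _).2]
  gcongr with k
  · exact (hvar (hν.memLp_source k)).trans (hν.power_source k)
  · exact (hvar hν.memLp_relay).trans hν.power_relay

/-- For `S = ∅` and `a = 1` the residual is `X_r` minus a linear estimate from all sources, and its
variance is at most `(1 - ∑ γ_k) P_r`. -/
lemma mem_GammaOB (hν : M.IsAdmissible ν) (hγ : M.HasCorrelation ν γ) : γ ∈ GammaOB K := by
  refine ⟨fun k => (hγ k).1, ?_⟩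
  have h := (variance_nonneg _ _).trans (variance_residual_le hν hγ ∅ 1)
  simp only [residualPower, gammaBarCompl, Finset.sum_empty, Finset.compl_empty] at h
  have h' : 0 ≤ (1 - ∑ k, γ k) * M.Pr := by linarith
  linarith [nonneg_of_mul_nonneg_left h' M.Pr_pos]

end Moments

/-! ### Upper bounds for all admissible inputs -/

section Bounds

variable {M}

lemma sum_eq_sum_restrict_add (S : Finset (Fin K)) (x : Fin K → ℝ) :
    ∑ k, x k = ∑ k : S, x k + ∑ k : ↥Sᶜ, x k := by
  rw [Finset.sum_coe_sort S x, Finset.sum_coe_sort Sᶜ x, Finset.sum_add_sum_compl]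

variable (M) in
/-- The relay estimates `∑ X_k` from `(X_r, X_{Sᶜ})` by this function. -/
def relayEstimate (γ : Fin K → ℝ) (S : Finset (Fin K)) (z : ℝ × (↥Sᶜ → ℝ)) : ℝ :=
  ∑ k : ↥Sᶜ, (1 - M.residualCoeff γ S (M.relayResidualCoeff γ S) k) * z.2 k -
    M.relayResidualCoeff γ S * z.1

variable (M) in
/-- The destination estimates `∑ X_k + X_r` from `X_{Sᶜ}` by this function. -/
def destEstimate (γ : Fin K → ℝ) (S : Finset (Fin K)) (z : ↥Sᶜ → ℝ) : ℝ :=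
  ∑ k : ↥Sᶜ, (1 - M.residualCoeff γ S 1 k) * z k

/-- The source part of "estimate plus residual equals signal"; the `X_r` terms are balanced
separately. -/
lemma sum_residualCoeff_mul (γ : Fin K → ℝ) (S : Finset (Fin K)) (a : ℝ) (x : Fin K → ℝ) :
    ∑ k : ↥Sᶜ, (1 - M.residualCoeff γ S a k) * x k + ∑ k, M.residualCoeff γ S a k * x k =
      ∑ k : S, x k + ∑ k : ↥Sᶜ, x k := by
  rw [sum_eq_sum_restrict_add S fun k => M.residualCoeff γ S a k * x k]
  have h : ∑ k : S, M.residualCoeff γ S a k * x k = ∑ k : S, x k :=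
    Finset.sum_congr rfl fun k _ => by simp [residualCoeff]
  rw [h, add_left_comm, ← Finset.sum_add_distrib]
  congr 1
  exact Finset.sum_congr rfl fun k _ => by ring

lemma map_fst_noise : ((gaussianReal 0 M.Nr).prod (gaussianReal 0 M.NΔ)).map
    (ContinuousLinearMap.fst ℝ ℝ ℝ) = gaussianReal 0 M.Nr := by
  rw [ContinuousLinearMap.coe_fst', Measure.map_fst_prod, measure_univ, one_smul]

lemma map_add_noise : ((gaussianReal 0 M.Nr).prod (gaussianReal 0 M.NΔ)).map
    (ContinuousLinearMap.fst ℝ ℝ ℝ + ContinuousLinearMap.snd ℝ ℝ ℝ) =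
      gaussianReal 0 (M.Nr + M.NΔ) := by
  have h := gaussianReal_conv_gaussianReal (m₁ := 0) (m₂ := 0) (v₁ := M.Nr) (v₂ := M.NΔ)
  rw [add_zero] at h
  exact h

variable {ν : Measure (Input K)} [IsProbabilityMeasure ν] {γ : Fin K → ℝ}

lemma relayBound_le (hν : M.IsAdmissible ν) (hγ : M.HasCorrelation ν γ) (S : Finset (Fin K)) :
    M.relayBound ν S ≤ ENNReal.ofReal (M.relayClosedForm γ S) := by
  rw [relayClosedForm_eq]
  refine condMutualInfo_le_of_variance_le (X := fun x => S.restrict x.1)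
    (Z := fun x => (x.2, Sᶜ.restrict x.1)) (n := ContinuousLinearMap.fst ℝ ℝ ℝ)
    (F := fun p => ∑ k, p.2 k + ∑ k, p.1.2 k) (g := M.relayEstimate γ S)
    (W := linInput (M.residualCoeff γ S (M.relayResidualCoeff γ S)) (M.relayResidualCoeff γ S))
    (by fun_prop) (by fun_prop) (by fun_prop) (by fun_prop)
    (by unfold relayEstimate; fun_prop) (fun ω => ?_) (fun x => ?_) map_fst_noise M.Nr_pos.ne'
    (memLp_linInput hν.memLp_source hν.memLp_relay _ _) (variance_residual_le hν hγ _ _)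
  · simp [Yr, sum_eq_sum_restrict_add S ω.1.1]
  · have h := sum_residualCoeff_mul (M := M) γ S (M.relayResidualCoeff γ S) x.1
    simp only [relayEstimate, linInput_apply, Finset.restrict_def]
    linarith

lemma destBound_le (hν : M.IsAdmissible ν) (hγ : M.HasCorrelation ν γ) (S : Finset (Fin K)) :
    M.destBound ν S ≤ ENNReal.ofReal (M.destClosedForm γ S) := by
  rw [destClosedForm_eq]
  refine condMutualInfo_le_of_variance_le (X := fun x => (S.restrict x.1, x.2))
    (Z := fun x => Sᶜ.restrict x.1)
    (n := ContinuousLinearMap.fst ℝ ℝ ℝ + ContinuousLinearMap.snd ℝ ℝ ℝ)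
    (F := fun p => ∑ k, p.2.1 k + ∑ k, p.1 k + p.2.2) (g := M.destEstimate γ S)
    (W := linInput (M.residualCoeff γ S 1) 1)
    (by fun_prop) (by fun_prop) (by fun_prop) (by fun_prop)
    (by unfold destEstimate; fun_prop) (fun ω => ?_) (fun x => ?_) map_add_noise
    (add_pos_of_pos_of_nonneg M.Nr_pos zero_le).ne'
    (memLp_linInput hν.memLp_source hν.memLp_relay _ _) (variance_residual_le hν hγ _ _)
  · simp [Yd, Yr, Xr, sum_eq_sum_restrict_add S ω.1.1]; ring
  · have h := sum_residualCoeff_mul (M := M) γ S 1 x.1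
    simp only [destEstimate, linInput_apply, Finset.restrict_def]
    linarith

end Bounds

/-! ### Equality for full-power Gaussian inputs -/

section Gaussian

variable {M} {ν : Measure (Input K)} {γ : Fin K → ℝ}

lemma IsFullPowerGaussian.variance_source (hG : M.IsFullPowerGaussian ν) (hν : M.IsAdmissible ν)
    (k : Fin K) : Var[fun x : Input K => x.1 k; ν] = M.P k := by
  rw [variance_of_integral_eq_zero (hν.memLp_source k).aemeasurable (hG.mean_source k),
    hG.power_source k]

lemma IsFullPowerGaussian.variance_relay (hG : M.IsFullPowerGaussian ν) (hν : M.IsAdmissible ν) :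
    Var[fun x : Input K => x.2; ν] = M.Pr := by
  rw [variance_of_integral_eq_zero hν.memLp_relay.aemeasurable hG.mean_relay, hG.power_relay]

variable [IsProbabilityMeasure ν]

lemma IsFullPowerGaussian.variance_residual (hG : M.IsFullPowerGaussian ν)
    (hν : M.IsAdmissible ν) (hγ : M.HasCorrelation ν γ) (S : Finset (Fin K)) (a : ℝ) :
    Var[linInput (M.residualCoeff γ S a) a; ν] = M.residualPower γ S a := by
  rw [variance_linInput hν.indep hν.memLp_source hν.memLp_relay,
    residualPower_eq fun k => (hγ k).1]
  simp only [(hγ _).2, hG.variance_source hν, hG.variance_relay hν]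

lemma IsFullPowerGaussian.integral_linInput (hG : M.IsFullPowerGaussian ν)
    (hν : M.IsAdmissible ν) (b : Fin K → ℝ) (a : ℝ) : ∫ x, linInput b a x ∂ν = 0 := by
  have hs k : Integrable (fun x : Input K => b k * x.1 k) ν :=
    ((hν.memLp_source k).integrable one_le_two).const_mul _
  have hr := (hν.memLp_relay.integrable one_le_two).const_mul a
  simp only [linInput_apply]
  rw [integral_add (integrable_finsetSum _ fun k _ => hs k) hr,
    integral_finsetSum _ fun k _ => hs k]
  simp [integral_const_mul, hG.mean_source, hG.mean_relay]

/-- At full power the coefficient on `Sᶜ` is exactly the one that cancels `a · cov(X_k, X_r)`. -/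
lemma IsFullPowerGaussian.covariance_source_residual (hG : M.IsFullPowerGaussian ν)
    (hν : M.IsAdmissible ν) (hγ : M.HasCorrelation ν γ) {S : Finset (Fin K)} (a : ℝ) {k : Fin K}
    (hk : k ∉ S) :
    cov[fun x : Input K => x.1 k, linInput (M.residualCoeff γ S a) a; ν] = 0 := by
  rw [covariance_source_linInput hν.indep hν.memLp_source hν.memLp_relay, ← (hγ k).2,
    hG.variance_source hν, residualCoeff, if_neg hk]
  have := (M.P_pos k).ne'
  field_simp
  ring

/-- This covariance is the left side of the normal equation for `a`. Only the relay bound needs it,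
because there `X_r` is conditioned on. -/
lemma IsFullPowerGaussian.covariance_relay_residual (hG : M.IsFullPowerGaussian ν)
    (hν : M.IsAdmissible ν) (hγ : M.HasCorrelation ν γ) (S : Finset (Fin K)) :
    cov[fun x : Input K => x.2, linInput
      (M.residualCoeff γ S (M.relayResidualCoeff γ S)) (M.relayResidualCoeff γ S); ν] = 0 := by
  rw [covariance_relay_linInput hν.memLp_source hν.memLp_relay, hG.variance_relay hν]
  simp only [← (hγ _).2]
  rw [sum_residualCoeff_mul_sqrt fun k => (hγ k).1,
    ← gammaBarCompl_mul_relayResidualCoeff (mem_GammaOB hν hγ) S, gammaBarCompl]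
  ring

lemma relayBound_eq (hν : M.IsAdmissible ν) (hG : M.IsFullPowerGaussian ν)
    (hγ : M.HasCorrelation ν γ) (S : Finset (Fin K)) :
    M.relayBound ν S = ENNReal.ofReal (M.relayClosedForm γ S) := by
  have := hG.gaussian
  rw [relayClosedForm_eq]
  refine condMutualInfo_eq_of_isGaussian (X := fun x => S.restrict x.1)
    (Z := (ContinuousLinearMap.snd ℝ _ _).prod
      ((ContinuousLinearMap.pi fun k : ↥Sᶜ => ContinuousLinearMap.proj (k : Fin K)).comp
        (ContinuousLinearMap.fst ℝ _ _)))
    (n := ContinuousLinearMap.fst ℝ ℝ ℝ)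
    (F := fun p => ∑ k, p.2 k + ∑ k, p.1.2 k) (g := M.relayEstimate γ S)
    (W := linInput (M.residualCoeff γ S (M.relayResidualCoeff γ S)) (M.relayResidualCoeff γ S))
    (by fun_prop) (by fun_prop)
    (by unfold relayEstimate; fun_prop) (fun ω => ?_) (fun x => ?_) map_fst_noise M.Nr_pos.ne'
    (hG.integral_linInput hν _ _) (hG.variance_residual hν hγ _ _) fun ℓ => ?_
  · simp [Yr, sum_eq_sum_restrict_add S ω.1.1]
  · have h := sum_residualCoeff_mul (M := M) γ S (M.relayResidualCoeff γ S) x.1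
    simp only [relayEstimate, linInput_apply, Finset.restrict_def, ContinuousLinearMap.prod_apply,
      ContinuousLinearMap.coe_snd', ContinuousLinearMap.comp_apply, ContinuousLinearMap.coe_fst',
      ContinuousLinearMap.pi_apply, ContinuousLinearMap.proj_apply]
    linarith
  · have hs := hν.memLp_source
    rw [eq_linInput (ℓ.comp _), covariance_comm, covariance_linInput_right hs hν.memLp_relay _ _
      (memLp_linInput hs hν.memLp_relay _ _), covariance_comm _ (fun x : Input K => x.2),
      hG.covariance_relay_residual hν hγ, mul_zero, add_zero]
    refine Finset.sum_eq_zero fun k _ => ?_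
    -- For `k ∈ S`, `Z` does not involve `X_k`, so its coefficient in `ℓ ∘ Z` is zero; otherwise the
    -- residual is uncorrelated with `X_k`.
    by_cases hk : k ∈ S
    · refine mul_eq_zero_of_left ?_ _
      rw [ContinuousLinearMap.comp_apply]
      convert map_zero ℓ
      ext j
      · simp
      · have : (j : Fin K) ≠ k := fun h => Finset.mem_compl.1 j.2 (h ▸ hk)
        simp [this]
    · rw [covariance_comm, hG.covariance_source_residual hν hγ _ hk, mul_zero]

lemma destBound_eq (hν : M.IsAdmissible ν) (hG : M.IsFullPowerGaussian ν)
    (hγ : M.HasCorrelation ν γ) (S : Finset (Fin K)) :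
    M.destBound ν S = ENNReal.ofReal (M.destClosedForm γ S) := by
  have := hG.gaussian
  rw [destClosedForm_eq]
  refine condMutualInfo_eq_of_isGaussian (X := fun x => (S.restrict x.1, x.2))
    (Z := (ContinuousLinearMap.pi fun k : ↥Sᶜ => ContinuousLinearMap.proj (k : Fin K)).comp
        (ContinuousLinearMap.fst ℝ _ _))
    (n := ContinuousLinearMap.fst ℝ ℝ ℝ + ContinuousLinearMap.snd ℝ ℝ ℝ)
    (F := fun p : (↥Sᶜ → ℝ) × ((S → ℝ) × ℝ) => ∑ k, p.2.1 k + ∑ k, p.1 k + p.2.2) (g := M.destEstimate γ S)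
    (W := linInput (M.residualCoeff γ S 1) 1)
    (by fun_prop) (by fun_prop)
    (by unfold destEstimate; fun_prop) (fun ω => ?_) (fun x => ?_) map_add_noise
    (add_pos_of_pos_of_nonneg M.Nr_pos zero_le).ne'
    (hG.integral_linInput hν _ _) (hG.variance_residual hν hγ _ _) fun ℓ => ?_
  · simp [Yd, Yr, Xr, sum_eq_sum_restrict_add S ω.1.1]; ring
  · have h := sum_residualCoeff_mul (M := M) γ S 1 x.1
    simp only [destEstimate, linInput_apply, Finset.restrict_def,
      ContinuousLinearMap.comp_apply, ContinuousLinearMap.coe_fst',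
      ContinuousLinearMap.pi_apply, ContinuousLinearMap.proj_apply]
    linarith
  · have hs := hν.memLp_source
    rw [eq_linInput (ℓ.comp _), covariance_comm, covariance_linInput_right hs hν.memLp_relay _ _
      (memLp_linInput hs hν.memLp_relay _ _)]
    -- Here `Z` does not contain `X_r`.
    have h0 : (ℓ.comp ((ContinuousLinearMap.pi fun k : ↥Sᶜ =>
        ContinuousLinearMap.proj (R := ℝ) (φ := fun _ : Fin K => ℝ) (k : Fin K)).comp
        (ContinuousLinearMap.fst ℝ (Fin K → ℝ) ℝ))) (0, 1) = 0 := by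
      rw [ContinuousLinearMap.comp_apply]
      convert map_zero ℓ
      ext j
      simp
    rw [h0, zero_mul, add_zero]
    refine Finset.sum_eq_zero fun k _ => ?_
    by_cases hk : k ∈ S
    · refine mul_eq_zero_of_left ?_ _
      rw [ContinuousLinearMap.comp_apply]
      convert map_zero ℓ
      ext j
      have : (j : Fin K) ≠ k := fun h => Finset.mem_compl.1 j.2 (h ▸ hk)
      simp [this]
    · rw [covariance_comm, hG.covariance_source_residual hν hγ _ hk, mul_zero]

end Gaussian

/-! ### Construction of Gaussian inputs with a given correlation vector -/

section Existence

variable {γ : Fin K → ℝ}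

/-- Independent zero-mean Gaussian sources of full power and an independent standard Gaussian
variable in the place of the relay input. -/
def independentGaussian : Measure (Input K) :=
  (Measure.pi fun k => gaussianReal 0 (M.P k).toNNReal).prod (gaussianReal 0 1)

instance : IsProbabilityMeasure M.independentGaussian := by
  unfold independentGaussian; infer_instance

instance isGaussian_independentGaussian : IsGaussian M.independentGaussian := by
  have h : IsGaussian (Measure.pi fun k => gaussianReal 0 (M.P k).toNNReal) := by
    have h := (iIndepFun_pi (μ := fun k => gaussianReal 0 (M.P k).toNNReal)
      (X := fun _ => id) fun _ => aemeasurable_id).hasGaussianLaw fun k =>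
        ((measurePreserving_eval _ k).hasLaw.hasGaussianLaw)
    simpa using h.isGaussian_map
  unfold independentGaussian
  infer_instance

lemma map_fst_independentGaussian :
    M.independentGaussian.map (fun x => x.1) =
      Measure.pi fun k => gaussianReal 0 (M.P k).toNNReal := by
  have h := Measure.map_fst_prod (μ := Measure.pi fun k => gaussianReal 0 (M.P k).toNNReal)
    (ν := gaussianReal 0 1)
  rwa [measure_univ, one_smul] at h

lemma map_source_independentGaussian (k : Fin K) :
    M.independentGaussian.map (fun x => x.1 k) = gaussianReal 0 (M.P k).toNNReal := by
  have h := (measurePreserving_eval (fun k => gaussianReal 0 (M.P k).toNNReal) k).map_eq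
  rw [← map_fst_independentGaussian, Measure.map_map (measurable_pi_apply k) measurable_fst] at h
  exact h

lemma map_relay_independentGaussian :
    M.independentGaussian.map (fun x => x.2) = gaussianReal 0 1 := by
  have h := Measure.map_snd_prod (μ := Measure.pi fun k => gaussianReal 0 (M.P k).toNNReal)
    (ν := gaussianReal 0 1)
  rwa [measure_univ, one_smul] at h

/-- Independence depends only on the marginal of the sources, so it survives replacing the relay
coordinate. -/
lemma iIndepFun_of_map_fst {ν : Measure (Input K)} [IsProbabilityMeasure ν]
    {μ : Fin K → Measure ℝ} [∀ k, IsProbabilityMeasure (μ k)]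
    (h : ν.map (fun x => x.1) = Measure.pi μ) :
    iIndepFun (fun (k : Fin K) (x : Input K) => x.1 k) ν := by
  rw [iIndepFun_iff_map_fun_eq_pi_map fun k => by fun_prop]
  refine h.trans ?_
  congr with k : 1
  rw [← (measurePreserving_eval μ k).map_eq, ← h,
    Measure.map_map (measurable_pi_apply k) measurable_fst]
  rfl

lemma integral_of_map_eq_gaussianReal {Ω : Type*} [MeasurableSpace Ω] {μ : Measure Ω} {U : Ω → ℝ}
    (hU : Measurable U) {m : ℝ} {v : ℝ≥0} (h : μ.map U = gaussianReal m v) :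
    ∫ ω, U ω ∂μ = m := by
  rw [← integral_id_gaussianReal (μ := m) (v := v), ← h, integral_map hU.aemeasurable (by fun_prop)]

lemma variance_of_map_eq_gaussianReal {Ω : Type*} [MeasurableSpace Ω] {μ : Measure Ω} {U : Ω → ℝ}
    (hU : Measurable U) {m : ℝ} {v : ℝ≥0} (h : μ.map U = gaussianReal m v) :
    Var[U; μ] = v := by
  rw [← variance_id_map hU.aemeasurable, h, variance_id_gaussianReal]

lemma memLp_independentGaussian (ℓ : Input K →L[ℝ] ℝ) : MemLp ℓ 2 M.independentGaussian :=
  IsGaussian.memLp_dual _ ℓ 2 (by simp)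

lemma memLp_source_independentGaussian (k : Fin K) :
    MemLp (fun x : Input K => x.1 k) 2 M.independentGaussian :=
  M.memLp_independentGaussian ((ContinuousLinearMap.proj k).comp (ContinuousLinearMap.fst ℝ _ _))

lemma memLp_relay_independentGaussian :
    MemLp (fun x : Input K => x.2) 2 M.independentGaussian :=
  M.memLp_independentGaussian (ContinuousLinearMap.snd ℝ _ _)

lemma covariance_independentGaussian (k : Fin K) :
    cov[fun x : Input K => x.1 k, fun x => x.2; M.independentGaussian] = 0 :=
  (indepFun_prod (X := fun x : Fin K → ℝ => x k) (Y := fun y : ℝ => y) (by fun_prop)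
    (by fun_prop)).covariance_eq_zero (M.memLp_source_independentGaussian k)
    M.memLp_relay_independentGaussian

/-- The relay input `∑ √(γ_k P_r / P_k) X_k + √((1 - ∑ γ_k) P_r) G` made of the sources and of an
independent standard Gaussian variable `G`. -/
def correlatedRelayInput (γ : Fin K → ℝ) : Input K →L[ℝ] ℝ :=
  linInput (fun k => √(γ k * M.P k * M.Pr) / M.P k) √((1 - ∑ k, γ k) * M.Pr)

/-- Full-power Gaussian inputs with the correlation vector `γ`. -/
def correlatedGaussian (γ : Fin K → ℝ) : Measure (Input K) :=
  M.independentGaussian.map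
    ((ContinuousLinearMap.fst ℝ (Fin K → ℝ) ℝ).prod (M.correlatedRelayInput γ))

instance (γ : Fin K → ℝ) : IsGaussian (M.correlatedGaussian γ) := by
  unfold correlatedGaussian; infer_instance

lemma integral_correlatedGaussian (γ : Fin K → ℝ) {u : Input K → ℝ} (hu : Measurable u) :
    ∫ x, u x ∂M.correlatedGaussian γ =
      ∫ x, u (x.1, M.correlatedRelayInput γ x) ∂M.independentGaussian :=
  integral_map (by fun_prop) hu.aestronglyMeasurable

lemma iIndepFun_correlatedGaussian (γ : Fin K → ℝ) :
    iIndepFun (fun (k : Fin K) (x : Input K) => x.1 k) (M.correlatedGaussian γ) := by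
  refine iIndepFun_of_map_fst (μ := fun k => gaussianReal 0 (M.P k).toNNReal) ?_
  rw [← map_fst_independentGaussian, correlatedGaussian,
    Measure.map_map measurable_fst (by fun_prop)]
  rfl

lemma variance_source_independentGaussian (k : Fin K) :
    Var[fun x : Input K => x.1 k; M.independentGaussian] = M.P k := by
  rw [variance_of_map_eq_gaussianReal (by fun_prop) (M.map_source_independentGaussian k),
    Real.coe_toNNReal _ (M.P_pos k).le]

lemma integral_source_independentGaussian (k : Fin K) :
    ∫ x, x.1 k ∂M.independentGaussian = 0 :=
  integral_of_map_eq_gaussianReal (by fun_prop) (M.map_source_independentGaussian k)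

lemma integral_correlatedRelayInput (γ : Fin K → ℝ) :
    ∫ x, M.correlatedRelayInput γ x ∂M.independentGaussian = 0 := by
  simp only [correlatedRelayInput, linInput_apply]
  rw [integral_add, integral_finsetSum, integral_const_mul,
    integral_of_map_eq_gaussianReal measurable_snd M.map_relay_independentGaussian]
  · simp [integral_const_mul, integral_source_independentGaussian]
  · exact fun k _ => ((M.memLp_source_independentGaussian k).integrable one_le_two).const_mul _
  · exact integrable_finsetSum _ fun k _ =>
      ((M.memLp_source_independentGaussian k).integrable one_le_two).const_mul _
  · exact (M.memLp_relay_independentGaussian.integrable one_le_two).const_mul _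

/-- Source `k` contributes `γ_k P_r` and the fresh variable the remaining `(1 - ∑ γ_k) P_r`,
nonnegative because `γ ∈ Γ_OB`. -/
lemma variance_correlatedRelayInput (hγ : γ ∈ GammaOB K) :
    Var[M.correlatedRelayInput γ; M.independentGaussian] = M.Pr := by
  rw [correlatedRelayInput, variance_linInput (iIndepFun_of_map_fst M.map_fst_independentGaussian)
    M.memLp_source_independentGaussian M.memLp_relay_independentGaussian,
    variance_of_map_eq_gaussianReal measurable_snd M.map_relay_independentGaussian]
  simp only [variance_source_independentGaussian, covariance_independentGaussian, mul_zero,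
    Finset.sum_const_zero, div_pow, sq_sqrt_correlation hγ.1]
  rw [Real.sq_sqrt (mul_nonneg (sub_nonneg.2 hγ.2) M.Pr_pos.le)]
  have h (k) : γ k * M.P k * M.Pr / M.P k ^ 2 * M.P k = γ k * M.Pr := by
    have := (M.P_pos k).ne'
    field_simp
  simp only [h, ← Finset.sum_mul, NNReal.coe_one]
  ring

lemma isFullPowerGaussian_correlatedGaussian (hγ : γ ∈ GammaOB K) :
    M.IsFullPowerGaussian (M.correlatedGaussian γ) where
  gaussian := inferInstance
  mean_source k := by
    rw [integral_correlatedGaussian _ _ (by fun_prop)]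
    exact M.integral_source_independentGaussian k
  mean_relay := by
    rw [integral_correlatedGaussian _ _ (by fun_prop)]
    exact M.integral_correlatedRelayInput γ
  power_source k := by
    rw [integral_correlatedGaussian _ _ (by fun_prop), ← M.variance_source_independentGaussian k,
      variance_of_integral_eq_zero (by fun_prop) (M.integral_source_independentGaussian k)]
  power_relay := by
    rw [integral_correlatedGaussian _ _ (by fun_prop), ← M.variance_correlatedRelayInput hγ,
      variance_of_integral_eq_zero (by fun_prop) (M.integral_correlatedRelayInput γ)]

lemma isAdmissible_correlatedGaussian (hγ : γ ∈ GammaOB K) :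
    M.IsAdmissible (M.correlatedGaussian γ) where
  indep := M.iIndepFun_correlatedGaussian γ
  memLp_source k := IsGaussian.memLp_dual _
    ((ContinuousLinearMap.proj k).comp (ContinuousLinearMap.fst ℝ (Fin K → ℝ) ℝ)) 2 (by simp)
  memLp_relay := IsGaussian.memLp_dual _ (ContinuousLinearMap.snd ℝ (Fin K → ℝ) ℝ) 2 (by simp)
  power_source k := ((M.isFullPowerGaussian_correlatedGaussian hγ).power_source k).le
  power_relay := (M.isFullPowerGaussian_correlatedGaussian hγ).power_relay.le

lemma hasCorrelation_correlatedGaussian (hγ : γ ∈ GammaOB K) :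
    M.HasCorrelation (M.correlatedGaussian γ) γ := by
  refine fun k => ⟨hγ.1 k, ?_⟩
  rw [correlatedGaussian, covariance_map_fun (by fun_prop) (by fun_prop) (by fun_prop)]
  have h := covariance_source_linInput (iIndepFun_of_map_fst M.map_fst_independentGaussian)
    M.memLp_source_independentGaussian M.memLp_relay_independentGaussian
    (fun k => √(γ k * M.P k * M.Pr) / M.P k) √((1 - ∑ k, γ k) * M.Pr) k
  rw [covariance_independentGaussian, variance_source_independentGaussian, mul_zero, add_zero,
    div_mul_cancel₀ _ (M.P_pos k).ne'] at h
  exact h.symm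

end Existence

end DegradedGaussianMARC

end

theorem mainTheorem5 {K : ℕ} (M : DegradedGaussianMARC K) :
    -- every admissible input law obeys the closed-form bounds of its correlation vector
    (∀ (ν : Measure (DegradedGaussianMARC.Input K)) [IsProbabilityMeasure ν] (γ : Fin K → ℝ),
      M.IsAdmissible ν → M.HasCorrelation ν γ →
        γ ∈ DegradedGaussianMARC.GammaOB K ∧
        ∀ S : Finset (Fin K),
          M.relayBound ν S ≤ ENNReal.ofReal (M.relayClosedForm γ S) ∧
          M.destBound ν S ≤ ENNReal.ofReal (M.destClosedForm γ S)) ∧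
    -- Gaussian inputs of full power attain them, for all `S`
    (∀ (ν : Measure (DegradedGaussianMARC.Input K)) [IsProbabilityMeasure ν] (γ : Fin K → ℝ),
      M.IsAdmissible ν → M.IsFullPowerGaussian ν → M.HasCorrelation ν γ →
        ∀ S : Finset (Fin K),
          M.relayBound ν S = ENNReal.ofReal (M.relayClosedForm γ S) ∧
          M.destBound ν S = ENNReal.ofReal (M.destClosedForm γ S)) ∧
    -- and such inputs exist for every correlation vector in `Γ_OB`
    (∀ γ ∈ DegradedGaussianMARC.GammaOB K,
      ∃ ν : Measure (DegradedGaussianMARC.Input K), IsProbabilityMeasure ν ∧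
        M.IsAdmissible ν ∧ M.IsFullPowerGaussian ν ∧ M.HasCorrelation ν γ) ∧
    -- the closed forms are nonnegative reals, so `ENNReal.ofReal` loses nothing
    (∀ γ ∈ DegradedGaussianMARC.GammaOB K, ∀ S : Finset (Fin K),
      0 ≤ M.relayClosedForm γ S ∧ 0 ≤ M.destClosedForm γ S) := by
  refine ⟨fun ν _ γ hν hγ => ⟨DegradedGaussianMARC.mem_GammaOB hν hγ, fun S =>
      ⟨DegradedGaussianMARC.relayBound_le hν hγ S, DegradedGaussianMARC.destBound_le hν hγ S⟩⟩,
    fun ν _ γ hν hG hγ S =>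
      ⟨DegradedGaussianMARC.relayBound_eq hν hG hγ S, DegradedGaussianMARC.destBound_eq hν hG hγ S⟩,
    fun γ hγ => ⟨M.correlatedGaussian γ, inferInstance, M.isAdmissible_correlatedGaussian hγ,
      M.isFullPowerGaussian_correlatedGaussian hγ, M.hasCorrelation_correlatedGaussian hγ⟩,
    fun γ hγ S => ⟨DegradedGaussianMARC.relayClosedForm_nonneg hγ S,
      DegradedGaussianMARC.destClosedForm_nonneg hγ S⟩⟩
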